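/- **Notation.** For a modulus $k\ge 0$ let $$F_J(\psi,k)=\int_0^\psi\frac{dt}{\sqrt{1-k^2\sin^2t}},\qquad E_J(\psi,k)=\int_0^\psi\sqrt{1-k^2\sin^2t}\,dt,\qquad K(k)=F_J(\pi/2,k),$$ where $\psi$ ranges over $D_k=\mathbb R$ if $k<1$, $D_k=(-\pi/2,\pi/2)$ if $k=1$, and $D_k=[-\arcsin\frac1k,\arcsin\frac1k]$ if $k>1$. Let $\mathrm{am}(\cdot,k)$ be the inverse of $F_J(\cdot,k):D_k\to F_J(D_k,k)$, and $\mathrm{sn}=\sin\mathrm{am}$, $\mathrm{cn}=\cos\mathrm{am}$, $\mathrm{dn}=\sqrt{1-k^2\mathrm{sn}^2}$. **Data.** Let $EI>0$, $L>0$ and let $X,Z$ (left-end force), $M$ (left-end moment) and $\varphi_a$ (left-end rotation) be real numbers, not satisfying both $M=0$ and $X\sin\varphi_a+Z\cos\varphi_a=0$ (in that excluded case the rotation is constant). Put $$\kappa_a=-\frac{M}{EI},\quad F=\sqrt{X^2+Z^2},\quad N=-X\cos\varphi_a+Z\sin\varphi_a,\quad c_1=\kappa_a^2+\frac{2N}{EI},\quad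 A=\frac{2F}{EI},$$ and let $s=\operatorname{sgn}\kappa_a$ if $\kappa_a\neq0$ and $s=-\operatorname{sgn}(X\sin\varphi_a+Z\cos\varphi_a)$ if $\kappa_a=0$. Then $c_1+A>0$, and we put $$k=\sqrt{\frac{2A}{c_1+A}}=\sqrt{\frac{4F}{2(F+N)+EI\kappa_a^2}}.$$ Let $\alpha$ be an angle of the end force, i.e. $F\cos\alpha=X$ and $F\sin\alpha=Z$, chosen such that $|\varphi_a+\alpha|\le\pi$ if $k\ge1$. Such an $\alpha$ exists; if $X>0$, then $\alpha=\arctan(Z/X)$ is one, provided that it meets the last requirement. Finally put $$a=F_J\Big(\frac{\varphi_a+\alpha}2,k\Big),\qquad b=\frac{s}{2}\sqrt{c_1+A}.$$ **Statement.** Say that $\varphi$ is a *rotation without inflexion point on $[0,L]$* if it is twice differentiable on $[0,L]$, satisfies $EI\varphi''+X\sin\varphi+Z\cos\varphi=0$ there, $\varphi(0)=\varphi_a$, $\varphi'(0)=\kappa_a$, and $\varphi'$ does not change its sign on $[0,L]$. The associated centerline displacements of the axially inextensible beam are the functions $u,w$ with $u'=\cos\varphi-1$, $w'=-\sin\varphi$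 on $[0,L]$. 1. $\varphi$ is a rotation without inflexion point on $[0,L]$ if and only if, for all $x\in[0,L]$, $a+bx\in F_J(D_k,k)$ and $$\varphi(x)=2\,\mathrm{am}(a+bx,k)-\alpha .$$ 2. Let $\varphi$ be as in 1 and $F>0$. Then $u,w$ are associated displacements if and only if there are constants $C_u,C_w$ such that on $[0,L]$ $$u(x)=C_u-x-\tfrac{2}{bk^2}\mathrm{dn}(a+bx,k)\sin\alpha+\Big(\tfrac{2}{bk^2}E_J(\mathrm{am}(a+bx,k),k)+x-\tfrac{2x}{k^2}\Big)\cos\alpha,$$ $$w(x)=C_w+\tfrac{2}{bk^2}\mathrm{dn}(a+bx,k)\cos\alpha+\Big(\tfrac{2}{bk^2}E_J(\mathrm{am}(a+bx,k),k)+x-\tfrac{2x}{k^2}\Big)\sin\alpha.$$ 3. One has $k>1$ if and only if $2F(1+\cos(\varphi_a+\alpha))>M^2/EI$. In this case put $\tilde k=1/k$, $\tilde a=ka$, $\tilde b=kb$. Then $$\tilde k=\sqrt{\sin^2\tfrac{\varphi_a+\alpha}2+\tfrac{M^2}{4EI\,F}},\quad \tilde a=F_J\Big(\arcsin\big(\tfrac1{\tilde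 k}\sin\tfrac{\varphi_a+\alpha}2\big),\tilde k\Big),\quad \tilde b=s\sqrt{F/EI};$$ $\varphi$ is a rotation without inflexion point on $[0,L]$ if and only if, for all $x\in[0,L]$, $|\tilde a+\tilde bx|\le K(\tilde k)$ and $$\varphi(x)=2\arcsin\big(\tilde k\,\mathrm{sn}(\tilde a+\tilde bx,\tilde k)\big)-\alpha;$$ and for such $\varphi$, $u,w$ are associated displacements if and only if there are constants $C_u,C_w$ such that on $[0,L]$ $$u(x)=C_u-x-\tfrac{2\tilde k}{\tilde b}\mathrm{cn}(\tilde a+\tilde bx,\tilde k)\sin\alpha+\Big(\tfrac{2}{\tilde b}E_J(\mathrm{am}(\tilde a+\tilde bx,\tilde k),\tilde k)-x\Big)\cos\alpha,$$ $$w(x)=C_w+\tfrac{2\tilde k}{\tilde b}\mathrm{cn}(\tilde a+\tilde bx,\tilde k)\cos\alpha+\Big(\tfrac{2}{\tilde b}E_J(\mathrm{am}(\tilde a+\tilde bx,\tilde k),\tilde k)-x\Big)\sin\alpha.$$ -/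

import Mathlib

noncomputable section

namespace InextensibleBeam

/-! ### Elliptic integrals and Jacobi elliptic functions (real, modulus `k ≥ 0`) -/

/-- Incomplete elliptic integral of the first kind. -/
def FJ (ψ k : ℝ) : ℝ := ∫ t in (0 : ℝ)..ψ, 1 / Real.sqrt (1 - k ^ 2 * Real.sin t ^ 2)

/-- Incomplete elliptic integral of the second kind. -/
def EJ (ψ k : ℝ) : ℝ := ∫ t in (0 : ℝ)..ψ, Real.sqrt (1 - k ^ 2 * Real.sin t ^ 2)

/-- Complete elliptic integral of the first kind. -/
def K (k : ℝ) : ℝ := FJ (Real.pi / 2) k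

/-- The set of amplitudes `ψ` for which the real integral `FJ ψ k` makes sense (`k ≥ 0`):
everything for `k < 1`, the open interval `(-π/2, π/2)` for `k = 1` (the integral diverges at
`±π/2`), and `[-arcsin (1/k), arcsin (1/k)]` for `k > 1` (the integrand is real exactly there, and
its endpoint singularity is integrable). -/
def amplitudes (k : ℝ) : Set ℝ :=
  if k < 1 then Set.univ
  else if k = 1 then Set.Ioo (-(Real.pi / 2)) (Real.pi / 2)
  else Set.Icc (-Real.arcsin (1 / k)) (Real.arcsin (1 / k))

/-- The arguments at which the Jacobi functions of modulus `k` are defined: the values of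
`FJ · k`. -/
def arguments (k : ℝ) : Set ℝ := (fun ψ => FJ ψ k) '' amplitudes k

/-- Jacobi amplitude: the inverse of `FJ · k`. -/
def am (y k : ℝ) : ℝ := Function.invFunOn (fun ψ => FJ ψ k) (amplitudes k) y

/-- Elliptic sine. -/
def sn (y k : ℝ) : ℝ := Real.sin (am y k)

/-- Elliptic cosine. -/
def cn (y k : ℝ) : ℝ := Real.cos (am y k)

/-- Delta amplitude. -/
def dn (y k : ℝ) : ℝ := Real.sqrt (1 - k ^ 2 * sn y k ^ 2)

/-! ### Beam data and the constants of the solution -/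

/-- Bending stiffness `EI`, the components `X`, `Z` of the left-end force, the left-end moment `M`
and the left-end rotation `φa`. -/
structure EndData where
  EI : ℝ
  X : ℝ
  Z : ℝ
  M : ℝ
  φa : ℝ

namespace EndData

variable (d : EndData)

/-- Left-end curvature. -/
def κa : ℝ := -d.M / d.EI

/-- Magnitude of the left-end force. -/
def F : ℝ := Real.sqrt (d.X ^ 2 + d.Z ^ 2)

/-- Normal force at the left end. -/
def N : ℝ := -d.X * Real.cos d.φa + d.Z * Real.sin d.φa

def c₁ : ℝ := d.κa ^ 2 + 2 * d.N / d.EI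

def A : ℝ := 2 * d.F / d.EI

/-- The modulus. -/
def k : ℝ := Real.sqrt (2 * d.A / (d.c₁ + d.A))

/-- Sign of the curvature near the left end: the sign of `κa`, or, if `κa = 0`, the sign of
`EI φ''(0) = -(X sin φa + Z cos φa)`. -/
def curvSign : ℝ :=
  if d.κa ≠ 0 then Real.sign d.κa
  else Real.sign (-(d.X * Real.sin d.φa + d.Z * Real.cos d.φa))

/-- `α` is the angle of the end force. It is determined modulo `2π`; for modulus `k ≥ 1`
the representative has to be chosen so that `φa + α` lies in `[-π, π]`. -/
structure IsPhase (α : ℝ) : Prop where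
  cos_eq : d.F * Real.cos α = d.X
  sin_eq : d.F * Real.sin α = d.Z
  branch : 1 ≤ d.k → |d.φa + α| ≤ Real.pi

def a (α : ℝ) : ℝ := FJ ((d.φa + α) / 2) d.k

def b : ℝ := Real.sqrt (d.c₁ + d.A) / 2 * d.curvSign

/-- Reciprocal modulus `k̃`. -/
def ktil : ℝ := 1 / d.k

/-- `ã`. -/
def atil (α : ℝ) : ℝ := d.k * d.a α

/-- `b̃`. -/
def btil : ℝ := d.k * d.b

/-- `φ` solves the rotation equation `EI φ'' + X sin φ + Z cos φ = 0` on `[0, L]`, with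
`φ(0) = φa` and `EI φ'(0) = -M`, and there is no inflexion point: the curvature `κ = φ'` does not
change its sign on `[0, L]` (it may vanish at the ends). -/
def IsRotation (L : ℝ) (φ : ℝ → ℝ) : Prop :=
  ∃ κ κ' : ℝ → ℝ,
    φ 0 = d.φa ∧ κ 0 = -d.M / d.EI ∧
    (∀ x ∈ Set.Icc 0 L, HasDerivWithinAt φ (κ x) (Set.Icc 0 L) x) ∧
    (∀ x ∈ Set.Icc 0 L, HasDerivWithinAt κ (κ' x) (Set.Icc 0 L) x) ∧
    (∀ x ∈ Set.Icc 0 L,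
      d.EI * κ' x + d.X * Real.sin (φ x) + d.Z * Real.cos (φ x) = 0) ∧
    (∀ x ∈ Set.Icc 0 L, ∀ y ∈ Set.Icc 0 L, 0 ≤ κ x * κ y)

end EndData

/-- `u`, `w` are centerline displacements on `[0, L]` of an axially inextensible beam with
rotation `φ`: `u' = cos φ - 1` and `w' = -sin φ`. -/
def IsDisplacement (L : ℝ) (φ u w : ℝ → ℝ) : Prop :=
  ∀ x ∈ Set.Icc 0 L,
    HasDerivWithinAt u (Real.cos (φ x) - 1) (Set.Icc 0 L) x ∧
    HasDerivWithinAt w (-Real.sin (φ x)) (Set.Icc 0 L) x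

end InextensibleBeam

end

open InextensibleBeam

namespace InextensibleBeam

open Real Set Topology

/-!
The half angle `θ = (φ + α) / 2` turns the rotation equation into the pendulum equation
`θ'' = -b² k² sin θ cos θ`, whose energy integral, normalised by the initial data, reads
`θ'² = b² (1 - k² sin² θ)`. That `φ'` keeps its sign is what allows the root to be taken:
`θ' = b √(1 - k² sin² θ)`, so `FJ θ k` grows linearly with slope `b`, and inverting `FJ` gives the
amplitude. Two cases need care. For `k = 1` the integral diverges at the equilibria `±π/2`, which
the solution cannot reach because solutions of the first order equation are unique. For `k > 1`
the radicand vanishes at the ends of the amplitude interval; `b θ'` has a minimum there without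
being stationary, so this can happen only at the ends of `[0, L]`, and `FJ` at these amplitudes is
controlled by the reciprocal modulus transformation `k FJ(ψ, k) = FJ(arcsin (k sin ψ), 1 / k)`.
-/

theorem eq_of_hasDerivWithinAt_zero {𝕜 E : Type*} [RCLike 𝕜] [NormedAddCommGroup E]
    [NormedSpace 𝕜 E] {s : Set 𝕜} {f : 𝕜 → E} (hs : Convex ℝ s)
    (hf : ∀ x ∈ s, HasDerivWithinAt f 0 s x) {x y : 𝕜} (hx : x ∈ s) (hy : y ∈ s) : f x = f y := by
  have h := hs.norm_image_sub_le_of_norm_hasDerivWithin_le hf (C := 0) (by simp) hy hx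
  rwa [zero_mul, norm_le_zero_iff, sub_eq_zero] at h

theorem forall_hasDerivWithinAt_iff_exists_eq_const_add {𝕜 E : Type*} [RCLike 𝕜]
    [NormedAddCommGroup E] [NormedSpace 𝕜 E] {s : Set 𝕜} {f f' : 𝕜 → E} (hs : Convex ℝ s)
    (hf : ∀ x ∈ s, HasDerivWithinAt f (f' x) s x) (u : 𝕜 → E) :
    (∀ x ∈ s, HasDerivWithinAt u (f' x) s x) ↔ ∃ C, ∀ x ∈ s, u x = C + f x := by
  constructor
  · intro hu
    rcases s.eq_empty_or_nonempty with rfl | ⟨x₀, hx₀⟩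
    · simp
    refine ⟨u x₀ - f x₀, fun x hx => ?_⟩
    have hconst : u x - f x = u x₀ - f x₀ :=
      eq_of_hasDerivWithinAt_zero (f := fun x => u x - f x) hs
        (fun y hy => ((hu y hy).sub (hf y hy)).congr_deriv (sub_self _)) hx hx₀
    rw [← hconst, sub_add_cancel]
  · rintro ⟨C, hC⟩ x hx
    exact ((hf x hx).const_add C).congr hC (hC x hx)

theorem hasDerivWithinAt_comp_affine {𝕜 : Type*} [NontriviallyNormedField 𝕜] {f : 𝕜 → 𝕜}
    {f' a b x : 𝕜} {s t : Set 𝕜} (hf : HasDerivWithinAt f f' t (a + b * x))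
    (h : MapsTo (fun x => a + b * x) s t) :
    HasDerivWithinAt (fun x => f (a + b * x)) (f' * b) s x := by
  have haff : HasDerivWithinAt (fun x => a + b * x) b s x :=
    (((hasDerivWithinAt_id x s).const_mul b).const_add a).congr_deriv (mul_one b)
  exact HasDerivWithinAt.comp x hf haff h

theorem eq_of_autonomous_of_right_eq_zero {E : Type*} [NormedAddCommGroup E] [NormedSpace ℝ E]
    {v : E → E} {C : NNReal} (hv : LipschitzWith C v) {θ : ℝ → E} {x y : ℝ} (hxy : x ≤ y)
    (hθ : ∀ t ∈ Icc x y, HasDerivWithinAt θ (v (θ t)) (Icc x y) t) (hy : v (θ y) = 0) :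
    θ x = θ y := by
  have hθ' : ∀ t ∈ Ioc x y, HasDerivWithinAt θ (v (θ t)) (Iic t) t := fun t ht =>
    (hθ t ⟨ht.1.le, ht.2⟩).mono_of_mem_nhdsWithin <|
      Filter.mem_of_superset (Icc_mem_nhdsLE ht.1) (Icc_subset_Icc_right ht.2)
  exact ODE_solution_unique_of_mem_Icc_left (v := fun _ => v) (s := fun _ => univ)
    (g := fun _ => θ y) (fun _ _ => hv.lipschitzOnWith)
    (fun t ht => (hθ t ht).continuousWithinAt) hθ' (fun _ _ => mem_univ _)
    continuousOn_const (fun _ _ => hy ▸ hasDerivWithinAt_const _ _ _) (fun _ _ => mem_univ _) rfl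
    ⟨le_rfl, hxy⟩

theorem exists_pos_of_hasDerivWithinAt_pos {f : ℝ → ℝ} {f' x y : ℝ} (hxy : x < y)
    (hf : HasDerivWithinAt f f' (Icc x y) x) (hx : f x = 0) (hf' : 0 < f') :
    ∃ z ∈ Icc x y, 0 < f z := by
  have hright := hf.mono_of_mem_nhdsWithin (Icc_mem_nhdsGT hxy)
  rw [hasDerivWithinAt_iff_tendsto_slope' (by simp)] at hright
  obtain ⟨z, hz, hxz⟩ :=
    ((hright.eventually_const_lt hf').and (Ioc_mem_nhdsGT hxy)).exists
  rw [slope_def_field, hx, sub_zero] at hz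
  exact ⟨z, ⟨hxz.1.le, hxz.2⟩, (div_pos_iff_of_pos_right (sub_pos.2 hxz.1)).1 hz⟩

theorem abs_lt_pi_div_two_of_cos_ne_zero {X : Type*} [TopologicalSpace X] {s : Set X} {θ : X → ℝ}
    (hs : IsPreconnected s) (hθ : ContinuousOn θ s) (hcos : ∀ x ∈ s, cos (θ x) ≠ 0) {x₀ x : X}
    (hx₀ : x₀ ∈ s) (h₀ : |θ x₀| ≤ π / 2) (hx : x ∈ s) : |θ x| < π / 2 := by
  by_contra! h
  obtain ⟨y, hy, hθy⟩ := hs.intermediate_value hx₀ hx hθ.abs ⟨h₀, h⟩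
  refine hcos y hy ?_
  calc cos (θ y) = cos |θ y| := (cos_abs _).symm
    _ = cos (π / 2) := congrArg cos hθy
    _ = 0 := cos_pi_div_two

theorem sin_eq_two_mul_sin_half_mul_cos_half (x : ℝ) : sin x = 2 * sin (x / 2) * cos (x / 2) := by
  rw [← sin_two_mul, mul_div_cancel₀ x two_ne_zero]

theorem cos_eq_one_sub_two_mul_sin_half_sq (x : ℝ) : cos x = 1 - 2 * sin (x / 2) ^ 2 := by
  rw [← cos_two_mul_eq_one_sub, mul_div_cancel₀ x two_ne_zero]

theorem sin_sq_lt_sin_sq_of_abs_lt {s t : ℝ} (hst : |s| < |t|) (ht : |t| ≤ π / 2) :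
    sin s ^ 2 < sin t ^ 2 := by
  have hcos : cos t < cos s := by
    rw [← cos_abs t, ← cos_abs s]
    exact cos_lt_cos_of_nonneg_of_le_pi_div_two (abs_nonneg s) ht hst
  have hsq : cos t ^ 2 < cos s ^ 2 :=
    pow_lt_pow_left₀ hcos (cos_nonneg_of_mem_Icc (abs_le.1 ht)) two_ne_zero
  rw [sin_sq, sin_sq]
  linarith

section Amplitudes

variable {k ψ t : ℝ}

theorem amplitudes_of_lt_one (hk : k < 1) : amplitudes k = univ := if_pos hk

theorem mem_amplitudes_of_lt_one (hk : k < 1) (ψ : ℝ) : ψ ∈ amplitudes k :=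
  amplitudes_of_lt_one hk ▸ mem_univ ψ

theorem amplitudes_one : amplitudes 1 = Ioo (-(π / 2)) (π / 2) := by
  simp [amplitudes]

theorem mem_Icc_arcsin_iff {x y : ℝ} (hx : x ∈ Icc (-1) 1) (hy : y ∈ Icc (-1) 1) :
    ψ ∈ Icc (arcsin x) (arcsin y) ↔ ψ ∈ Icc (-(π / 2)) (π / 2) ∧ sin ψ ∈ Icc x y := by
  have hiff : ψ ∈ Icc (-(π / 2)) (π / 2) →
      (ψ ∈ Icc (arcsin x) (arcsin y) ↔ sin ψ ∈ Icc x y) := fun h =>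
    and_congr (arcsin_le_iff_le_sin hx h) (le_arcsin_iff_sin_le h hy)
  have hsub : Icc (arcsin x) (arcsin y) ⊆ Icc (-(π / 2)) (π / 2) :=
    Icc_subset_Icc (neg_pi_div_two_le_arcsin x) (arcsin_le_pi_div_two y)
  exact ⟨fun h => ⟨hsub h, (hiff (hsub h)).1 h⟩, fun h => (hiff h.1).2 h.2⟩

theorem mem_amplitudes_of_one_lt (hk : 1 < k) :
    ψ ∈ amplitudes k ↔ ψ ∈ Icc (-(π / 2)) (π / 2) ∧ k * sin ψ ∈ Icc (-1) 1 := by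
  have hk₀ : 0 < k := one_pos.trans hk
  have hinv : 1 / k ∈ Icc (0 : ℝ) 1 := ⟨by positivity, (div_le_one hk₀).2 hk.le⟩
  have hamp : amplitudes k = Icc (arcsin (-(1 / k))) (arcsin (1 / k)) := by
    simp [amplitudes, not_lt.2 hk.le, hk.ne']
  have hscale : sin ψ ∈ Icc (-(1 / k)) (1 / k) ↔ k * sin ψ ∈ Icc (-1) 1 := by
    rw [mem_Icc, mem_Icc, ← abs_le, ← abs_le, abs_mul, abs_of_pos hk₀, le_div_iff₀' hk₀]
  rw [hamp, mem_Icc_arcsin_iff ⟨by linarith [hinv.2], by linarith [hinv.1]⟩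
    ⟨by linarith [hinv.1], hinv.2⟩, hscale]

theorem ordConnected_amplitudes (k : ℝ) : (amplitudes k).OrdConnected := by
  unfold amplitudes
  split_ifs <;> infer_instance

theorem isOpen_amplitudes (hk : k ≤ 1) : IsOpen (amplitudes k) := by
  rcases hk.lt_or_eq with hk | rfl
  · exact amplitudes_of_lt_one hk ▸ isOpen_univ
  · exact amplitudes_one ▸ isOpen_Ioo

theorem abs_le_pi_div_two_of_mem_amplitudes (hk : 1 ≤ k) (hψ : ψ ∈ amplitudes k) :
    |ψ| ≤ π / 2 := by
  rcases hk.eq_or_lt with rfl | hk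
  · exact abs_le.2 (Ioo_subset_Icc_self (amplitudes_one ▸ hψ))
  · exact abs_le.2 ((mem_amplitudes_of_one_lt hk).1 hψ).1

theorem mem_amplitudes_of_abs_lt (hk : 1 ≤ k) (hψ : |ψ| < π / 2)
    (hr : 0 ≤ 1 - k ^ 2 * sin ψ ^ 2) : ψ ∈ amplitudes k := by
  rcases hk.eq_or_lt with rfl | hk
  · exact amplitudes_one ▸ abs_lt.1 hψ
  · refine (mem_amplitudes_of_one_lt hk).2 ⟨abs_le.1 hψ.le, abs_le.1 ?_⟩
    rw [← sq_le_one_iff_abs_le_one, mul_pow]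
    linarith

theorem radicand_pos_of_le_one (hk₀ : 0 ≤ k) (hk : k ≤ 1) (hψ : ψ ∈ amplitudes k) :
    0 < 1 - k ^ 2 * sin ψ ^ 2 := by
  rcases hk.lt_or_eq with hk | rfl
  · have hk_sq : k ^ 2 < 1 := pow_lt_one₀ hk₀ hk two_ne_zero
    nlinarith [sin_sq_le_one ψ, sq_nonneg (sin ψ)]
  · rw [one_pow, one_mul, ← cos_sq']
    exact pow_pos (cos_pos_of_mem_Ioo (amplitudes_one ▸ hψ)) 2

theorem radicand_nonneg (hk₀ : 0 ≤ k) (hψ : ψ ∈ amplitudes k) : 0 ≤ 1 - k ^ 2 * sin ψ ^ 2 := by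
  rcases le_or_gt k 1 with hk | hk
  · exact (radicand_pos_of_le_one hk₀ hk hψ).le
  · have h := (sq_le_one_iff_abs_le_one _).2 (abs_le.2 ((mem_amplitudes_of_one_lt hk).1 hψ).2)
    rw [mul_pow] at h
    linarith

theorem radicand_pos_of_abs_lt (hk₀ : 0 ≤ k) (hψ : ψ ∈ amplitudes k) (ht : |t| < |ψ|) :
    0 < 1 - k ^ 2 * sin t ^ 2 := by
  rcases lt_or_ge k 1 with hk | hk
  · exact radicand_pos_of_le_one hk₀ hk.le (mem_amplitudes_of_lt_one hk t)
  · have hsin := sin_sq_lt_sin_sq_of_abs_lt ht (abs_le_pi_div_two_of_mem_amplitudes hk hψ)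
    have hmul : k ^ 2 * sin t ^ 2 < k ^ 2 * sin ψ ^ 2 := mul_lt_mul_of_pos_left hsin (by positivity)
    linarith [radicand_nonneg hk₀ hψ]

theorem radicand_pos_of_mem_uIcc (hk₀ : 0 ≤ k) (hψ : ψ ∈ amplitudes k)
    (hpos : 0 < 1 - k ^ 2 * sin ψ ^ 2) (ht : t ∈ uIcc 0 ψ) : 0 < 1 - k ^ 2 * sin t ^ 2 := by
  have hle : |t| ≤ |ψ| := by simpa using abs_sub_left_of_mem_uIcc ht
  rcases hle.lt_or_eq with hlt | heq
  · exact radicand_pos_of_abs_lt hk₀ hψ hlt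
  · rcases abs_eq_abs.1 heq with rfl | rfl
    · exact hpos
    · simpa using hpos

end Amplitudes

section EllipticIntegrals

variable {k ψ t : ℝ}

theorem FJ_neg (ψ k : ℝ) : FJ (-ψ) k = -FJ ψ k := by
  have h := intervalIntegral.integral_comp_neg (a := 0) (b := ψ)
    (fun t => 1 / √(1 - k ^ 2 * sin t ^ 2))
  simp only [sin_neg, neg_sq, neg_zero] at h
  rw [FJ, FJ, h, intervalIntegral.integral_symm]

theorem hasStrictDerivAt_FJ (hk₀ : 0 ≤ k) (hψ : ψ ∈ amplitudes k)
    (hpos : 0 < 1 - k ^ 2 * sin ψ ^ 2) :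
    HasStrictDerivAt (fun ψ => FJ ψ k) (1 / √(1 - k ^ 2 * sin ψ ^ 2)) ψ := by
  have hcont : ∀ t ∈ uIcc 0 ψ, ContinuousAt (fun t => 1 / √(1 - k ^ 2 * sin t ^ 2)) t :=
    fun t ht => ContinuousAt.div (by fun_prop) (by fun_prop)
      (sqrt_pos.2 (radicand_pos_of_mem_uIcc hk₀ hψ hpos ht)).ne'
  have hmeas : Measurable fun t => 1 / √(1 - k ^ 2 * sin t ^ 2) := by fun_prop
  exact intervalIntegral.integral_hasStrictDerivAt_right
    (ContinuousOn.intervalIntegrable fun t ht => (hcont t ht).continuousWithinAt)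
    hmeas.stronglyMeasurable.stronglyMeasurableAtFilter (hcont ψ right_mem_uIcc)

theorem hasDerivAt_EJ (ψ k : ℝ) : HasDerivAt (fun ψ => EJ ψ k) (√(1 - k ^ 2 * sin ψ ^ 2)) ψ := by
  have hcont : Continuous fun t => √(1 - k ^ 2 * sin t ^ 2) := by fun_prop
  exact (hcont.integral_hasStrictDerivAt 0 ψ).hasDerivAt

theorem continuousOn_FJ_of_le_one (hk₀ : 0 ≤ k) (hk : k ≤ 1) :
    ContinuousOn (fun ψ => FJ ψ k) (amplitudes k) := fun _ hψ =>
  (hasStrictDerivAt_FJ hk₀ hψ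
    (radicand_pos_of_le_one hk₀ hk hψ)).hasDerivAt.continuousAt.continuousWithinAt

theorem strictMonoOn_FJ_of_le_one (hk₀ : 0 ≤ k) (hk : k ≤ 1) :
    StrictMonoOn (fun ψ => FJ ψ k) (amplitudes k) := by
  refine strictMonoOn_of_deriv_pos (ordConnected_amplitudes k).convex
    (continuousOn_FJ_of_le_one hk₀ hk) fun ψ hψ => ?_
  have hpos := radicand_pos_of_le_one hk₀ hk (interior_subset hψ)
  rw [(hasStrictDerivAt_FJ hk₀ (interior_subset hψ) hpos).hasDerivAt.deriv]
  exact one_div_pos.2 (sqrt_pos.2 hpos)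

theorem continuous_FJ_of_lt_one (hk₀ : 0 ≤ k) (hk : k < 1) : Continuous fun ψ => FJ ψ k := by
  simpa only [amplitudes_of_lt_one hk, continuousOn_univ] using continuousOn_FJ_of_le_one hk₀ hk.le

theorem strictMono_FJ_of_lt_one (hk₀ : 0 ≤ k) (hk : k < 1) : StrictMono fun ψ => FJ ψ k := by
  simpa only [amplitudes_of_lt_one hk, strictMonoOn_univ] using strictMonoOn_FJ_of_le_one hk₀ hk.le

theorem one_div_nonneg_of_one_lt (hk : 1 < k) : 0 ≤ 1 / k :=
  one_div_nonneg.2 (one_pos.trans hk).le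

theorem one_div_lt_one_of_one_lt (hk : 1 < k) : 1 / k < 1 :=
  (div_lt_one (one_pos.trans hk)).2 hk

theorem hasDerivAt_arcsin_mul_sin (hr : 0 < 1 - k ^ 2 * sin t ^ 2) :
    HasDerivAt (fun t => arcsin (k * sin t)) (k * cos t / √(1 - k ^ 2 * sin t ^ 2)) t := by
  have habs : |k * sin t| < 1 := by
    rw [← sq_lt_one_iff_abs_lt_one, mul_pow]
    linarith
  have harcsin := hasDerivAt_arcsin (abs_lt.1 habs).1.ne' (abs_lt.1 habs).2.ne
  refine (harcsin.comp t ((hasDerivAt_sin t).const_mul k)).congr_deriv ?_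
  rw [mul_pow, one_div_mul_eq_div]

theorem hasDerivAt_FJ_arcsin_mul_sin (hk : 1 < k) (hcos : 0 < cos t)
    (hr : 0 < 1 - k ^ 2 * sin t ^ 2) :
    HasDerivAt (fun t => FJ (arcsin (k * sin t)) (1 / k))
      (k * (1 / √(1 - k ^ 2 * sin t ^ 2))) t := by
  have hk₀ : k ≠ 0 := (one_pos.trans hk).ne'
  have hmem : k * sin t ∈ Icc (-1) 1 := by
    rw [mem_Icc, ← abs_le, ← sq_le_one_iff_abs_le_one, mul_pow]
    linarith
  have hradicand : 1 - (1 / k) ^ 2 * sin (arcsin (k * sin t)) ^ 2 = cos t ^ 2 := by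
    rw [sin_arcsin' hmem, cos_sq']
    field_simp
  have hFJ := (hasStrictDerivAt_FJ (one_div_nonneg_of_one_lt hk)
    (mem_amplitudes_of_lt_one (one_div_lt_one_of_one_lt hk) _)
    (hradicand ▸ pow_pos hcos 2)).hasDerivAt
  rw [hradicand, sqrt_sq hcos.le] at hFJ
  refine (hFJ.comp t (hasDerivAt_arcsin_mul_sin hr)).congr_deriv ?_
  field_simp

theorem mul_FJ_eq_FJ_arcsin_mul_sin (hk : 1 < k) (hψ : ψ ∈ amplitudes k) :
    k * FJ ψ k = FJ (arcsin (k * sin ψ)) (1 / k) := by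
  have hcont : ContinuousOn (fun t => FJ (arcsin (k * sin t)) (1 / k)) (uIcc 0 ψ) :=
    ((continuous_FJ_of_lt_one (one_div_nonneg_of_one_lt hk)
      (one_div_lt_one_of_one_lt hk)).comp (by fun_prop)).continuousOn
  have habs : ∀ t ∈ Ioo (min 0 ψ) (max 0 ψ), |t| < |ψ| := by
    rintro t ⟨hmin, hmax⟩
    grind
  have hderiv : ∀ t ∈ Ioo (min 0 ψ) (max 0 ψ),
      HasDerivAt (fun t => FJ (arcsin (k * sin t)) (1 / k))
        (k * (1 / √(1 - k ^ 2 * sin t ^ 2))) t := fun t ht =>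
    hasDerivAt_FJ_arcsin_mul_sin hk
      (cos_pos_of_mem_Ioo (abs_lt.1 ((habs t ht).trans_le
        (abs_le_pi_div_two_of_mem_amplitudes hk.le hψ))))
      (radicand_pos_of_abs_lt (one_pos.trans hk).le hψ (habs t ht))
  -- A nonnegative derivative on the open interval suffices for integrability up to the singularity.
  have hint := intervalIntegral.intervalIntegrable_deriv_of_nonneg hcont hderiv
    fun t _ => by positivity
  have hftc := intervalIntegral.integral_eq_sub_of_hasDeriv_right hcont
    (fun t ht => (hderiv t ht).hasDerivWithinAt) hint
  rw [intervalIntegral.integral_const_mul] at hftc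
  simpa [FJ] using hftc

theorem strictMonoOn_FJ (hk₀ : 0 ≤ k) : StrictMonoOn (fun ψ => FJ ψ k) (amplitudes k) := by
  rcases le_or_gt k 1 with hk | hk
  · exact strictMonoOn_FJ_of_le_one hk₀ hk
  intro s hs t ht hst
  obtain ⟨hs_mem, hs_sin⟩ := (mem_amplitudes_of_one_lt hk).1 hs
  obtain ⟨ht_mem, ht_sin⟩ := (mem_amplitudes_of_one_lt hk).1 ht
  have hsin : k * sin s < k * sin t :=
    mul_lt_mul_of_pos_left (strictMonoOn_sin hs_mem ht_mem hst) (one_pos.trans hk)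
  have hFJ := strictMono_FJ_of_lt_one (one_div_nonneg_of_one_lt hk) (one_div_lt_one_of_one_lt hk)
    (strictMonoOn_arcsin hs_sin ht_sin hsin)
  simp only [← mul_FJ_eq_FJ_arcsin_mul_sin hk hs, ← mul_FJ_eq_FJ_arcsin_mul_sin hk ht] at hFJ
  exact lt_of_mul_lt_mul_left hFJ hk₀

theorem continuousOn_FJ (hk₀ : 0 ≤ k) : ContinuousOn (fun ψ => FJ ψ k) (amplitudes k) := by
  rcases le_or_gt k 1 with hk | hk
  · exact continuousOn_FJ_of_le_one hk₀ hk
  have hcont : Continuous fun ψ => FJ (arcsin (k * sin ψ)) (1 / k) / k :=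
    ((continuous_FJ_of_lt_one (one_div_nonneg_of_one_lt hk)
      (one_div_lt_one_of_one_lt hk)).comp (by fun_prop)).div_const k
  refine hcont.continuousOn.congr fun ψ hψ => ?_
  exact eq_div_of_mul_eq (one_pos.trans hk).ne'
    ((mul_comm _ _).trans (mul_FJ_eq_FJ_arcsin_mul_sin hk hψ))

end EllipticIntegrals

section JacobiFunctions

variable {k y : ℝ}

theorem am_mem_amplitudes (hy : y ∈ arguments k) : am y k ∈ amplitudes k :=
  Function.invFunOn_mem hy

theorem FJ_am (hy : y ∈ arguments k) : FJ (am y k) k = y :=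
  Function.invFunOn_eq hy

theorem am_FJ {ψ : ℝ} (hk₀ : 0 ≤ k) (hψ : ψ ∈ amplitudes k) : am (FJ ψ k) k = ψ :=
  (strictMonoOn_FJ hk₀).injOn.leftInvOn_invFunOn hψ

theorem dn_nonneg (y k : ℝ) : 0 ≤ dn y k := sqrt_nonneg _

theorem dn_sq (hk₀ : 0 ≤ k) (hy : y ∈ arguments k) : dn y k ^ 2 = 1 - k ^ 2 * sn y k ^ 2 :=
  sq_sqrt (radicand_nonneg hk₀ (am_mem_amplitudes hy))

theorem mul_sn_mem_Icc (hk₀ : 0 ≤ k) (hy : y ∈ arguments k) : k * sn y k ∈ Icc (-1) 1 := by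
  rw [mem_Icc, ← abs_le, ← sq_le_one_iff_abs_le_one, mul_pow]
  linarith [dn_sq hk₀ hy, sq_nonneg (dn y k)]

theorem abs_mul_le_K_of_mem_arguments (hk : 1 < k) (hy : y ∈ arguments k) :
    |k * y| ≤ K (1 / k) := by
  have hmono :=
    (strictMono_FJ_of_lt_one (one_div_nonneg_of_one_lt hk) (one_div_lt_one_of_one_lt hk)).monotone
  obtain ⟨ψ, hψ, rfl⟩ := hy
  simp only [mul_FJ_eq_FJ_arcsin_mul_sin hk hψ]
  rw [abs_le, K, ← FJ_neg]
  exact ⟨hmono (neg_pi_div_two_le_arcsin _), hmono (arcsin_le_pi_div_two _)⟩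

theorem mem_arguments_of_abs_mul_le_K (hk : 1 < k) (hy : |k * y| ≤ K (1 / k)) :
    y ∈ arguments k := by
  have hk₀ : 0 < k := one_pos.trans hk
  have hcont := continuous_FJ_of_lt_one (one_div_nonneg_of_one_lt hk) (one_div_lt_one_of_one_lt hk)
  rw [abs_le, K, ← FJ_neg] at hy
  obtain ⟨χ, hχ, hχy⟩ :=
    intermediate_value_Icc (neg_le_self pi_div_two_pos.le) hcont.continuousOn hy
  have hmem : 1 / k * sin χ ∈ Icc (-1) 1 := by
    rw [mem_Icc, ← abs_le, abs_mul, abs_of_nonneg (one_div_nonneg_of_one_lt hk)]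
    exact mul_le_one₀ (one_div_lt_one_of_one_lt hk).le (abs_nonneg _) (abs_sin_le_one χ)
  have hsin : k * sin (arcsin (1 / k * sin χ)) = sin χ := by
    rw [sin_arcsin' hmem, ← mul_assoc, mul_one_div_cancel hk₀.ne', one_mul]
  have hψ : arcsin (1 / k * sin χ) ∈ amplitudes k :=
    (mem_amplitudes_of_one_lt hk).2 ⟨arcsin_mem_Icc _, by rw [hsin]; exact sin_mem_Icc χ⟩
  refine ⟨_, hψ, mul_left_cancel₀ hk₀.ne' ?_⟩
  simp only [mul_FJ_eq_FJ_arcsin_mul_sin hk hψ, hsin, arcsin_sin' hχ]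
  exact hχy

theorem mem_arguments_iff_abs_mul_le_K (hk : 1 < k) : y ∈ arguments k ↔ |k * y| ≤ K (1 / k) :=
  ⟨abs_mul_le_K_of_mem_arguments hk, mem_arguments_of_abs_mul_le_K hk⟩

theorem mul_mem_arguments_one_div (hk : 1 < k) (hy : y ∈ arguments k) :
    k * y ∈ arguments (1 / k) := by
  obtain ⟨ψ, hψ, rfl⟩ := hy
  exact ⟨_, mem_amplitudes_of_lt_one (one_div_lt_one_of_one_lt hk) _,
    (mul_FJ_eq_FJ_arcsin_mul_sin hk hψ).symm⟩

theorem am_mul_one_div (hk : 1 < k) (hy : y ∈ arguments k) :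
    am (k * y) (1 / k) = arcsin (k * sn y k) := by
  rw [sn, ← am_FJ (one_div_nonneg_of_one_lt hk) (mem_amplitudes_of_lt_one
    (one_div_lt_one_of_one_lt hk) (arcsin (k * sin (am y k)))),
    ← mul_FJ_eq_FJ_arcsin_mul_sin hk (am_mem_amplitudes hy), FJ_am hy]

theorem sn_mul_one_div (hk : 1 < k) (hy : y ∈ arguments k) : sn (k * y) (1 / k) = k * sn y k := by
  rw [sn, am_mul_one_div hk hy, sin_arcsin' (mul_sn_mem_Icc (one_pos.trans hk).le hy)]

theorem cn_mul_one_div (hk : 1 < k) (hy : y ∈ arguments k) : cn (k * y) (1 / k) = dn y k := by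
  rw [cn, am_mul_one_div hk hy, cos_arcsin, dn, mul_pow]

theorem dn_mul_one_div (hk : 1 < k) (hy : y ∈ arguments k) : dn (k * y) (1 / k) = cn y k := by
  have hk₀ : k ≠ 0 := (one_pos.trans hk).ne'
  have hcn : 0 ≤ cn y k := cos_nonneg_of_mem_Icc
    (abs_le.1 (abs_le_pi_div_two_of_mem_amplitudes hk.le (am_mem_amplitudes hy)))
  have hradicand : 1 - (1 / k) ^ 2 * (k * sn y k) ^ 2 = cn y k ^ 2 := by
    rw [cn, cos_sq', sn]
    field_simp
  rw [dn, sn_mul_one_div hk hy, hradicand, sqrt_sq hcn]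

theorem am_eq_arcsin_one_div_mul_sn (hk : 1 < k) (hy : y ∈ arguments k) :
    am y k = arcsin (1 / k * sn (k * y) (1 / k)) := by
  rw [sn_mul_one_div hk hy, ← mul_assoc, one_div_mul_cancel (one_pos.trans hk).ne', one_mul, sn,
    arcsin_sin' ((mem_amplitudes_of_one_lt hk).1 (am_mem_amplitudes hy)).1]

theorem hasDerivAt_am_of_le_one (hk₀ : 0 ≤ k) (hk : k ≤ 1) (hy : y ∈ arguments k) :
    HasDerivAt (fun y => am y k) (dn y k) y := by
  obtain ⟨ψ, hψ, rfl⟩ := hy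
  have hpos := radicand_pos_of_le_one hk₀ hk hψ
  have hinv : ∀ᶠ t in 𝓝 ψ, am (FJ t k) k = t := by
    filter_upwards [(isOpen_amplitudes hk).mem_nhds hψ] with t ht using am_FJ hk₀ ht
  refine ((hasStrictDerivAt_FJ hk₀ hψ hpos).to_local_left_inverse
    (one_div_pos.2 (sqrt_pos.2 hpos)).ne' hinv).hasDerivAt.congr_deriv ?_
  rw [dn, sn, am_FJ hk₀ hψ, one_div, inv_inv]

theorem hasDerivAt_am_mul_one_div (hk : 1 < k) (hy : y ∈ arguments k) :
    HasDerivAt (fun y => am (k * y) (1 / k)) (k * cn y k) y := by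
  have ham := hasDerivAt_am_of_le_one (one_div_nonneg_of_one_lt hk)
    (one_div_lt_one_of_one_lt hk).le (mul_mem_arguments_one_div hk hy)
  refine (HasDerivAt.comp y ham ((hasDerivAt_id y).const_mul k)).congr_deriv ?_
  rw [dn_mul_one_div hk hy, mul_one, mul_comm]

theorem hasDerivWithinAt_am (hk₀ : 0 ≤ k) (hy : y ∈ arguments k) :
    HasDerivWithinAt (fun y => am y k) (dn y k) (arguments k) y := by
  rcases le_or_gt k 1 with hk | hk
  · exact (hasDerivAt_am_of_le_one hk₀ hk hy).hasDerivWithinAt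
  have hk_ne : k ≠ 0 := (one_pos.trans hk).ne'
  have hpos : 0 < 1 - (1 / k) ^ 2 * sin (am (k * y) (1 / k)) ^ 2 :=
    radicand_pos_of_le_one (one_div_nonneg_of_one_lt hk) (one_div_lt_one_of_one_lt hk).le
      (am_mem_amplitudes (mul_mem_arguments_one_div hk hy))
  have hcn : √(1 - (1 / k) ^ 2 * sin (am (k * y) (1 / k)) ^ 2) = cn y k := dn_mul_one_div hk hy
  have hcn_pos : 0 < cn y k := hcn.subst (sqrt_pos.2 hpos)
  have harcsin : HasDerivAt (fun t => arcsin (1 / k * sin t))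
      (1 / k * cn (k * y) (1 / k) / cn y k) (am (k * y) (1 / k)) :=
    (hasDerivAt_arcsin_mul_sin hpos).congr_deriv (congrArg _ hcn)
  refine ((HasDerivAt.comp y harcsin (hasDerivAt_am_mul_one_div hk hy)).hasDerivWithinAt.congr
    (fun z hz => am_eq_arcsin_one_div_mul_sn hk hz)
    (am_eq_arcsin_one_div_mul_sn hk hy)).congr_deriv ?_
  rw [cn_mul_one_div hk hy]
  field_simp

theorem hasDerivWithinAt_cn (hk₀ : 0 ≤ k) (hy : y ∈ arguments k) :
    HasDerivWithinAt (fun y => cn y k) (-sn y k * dn y k) (arguments k) y :=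
  (hasDerivWithinAt_am hk₀ hy).cos

theorem hasDerivWithinAt_dn (hk₀ : 0 ≤ k) (hy : y ∈ arguments k) :
    HasDerivWithinAt (fun y => dn y k) (-(k ^ 2 * sn y k * cn y k)) (arguments k) y := by
  rcases le_or_gt k 1 with hk | hk
  · have hpos := radicand_pos_of_le_one hk₀ hk (am_mem_amplitudes hy)
    have hdn : √(1 - k ^ 2 * sin (am y k) ^ 2) = dn y k := rfl
    have hdn_ne : dn y k ≠ 0 := (sqrt_pos.2 hpos).ne'
    have hradicand : HasDerivWithinAt (fun y => 1 - k ^ 2 * sin (am y k) ^ 2)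
        (-(2 * k ^ 2 * sn y k * cn y k * dn y k)) (arguments k) y :=
      ((((hasDerivWithinAt_am hk₀ hy).sin.pow 2).const_mul (k ^ 2)).const_sub 1).congr_deriv
        (by rw [sn, cn]; push_cast; ring)
    refine (hradicand.sqrt hpos.ne').congr_deriv ?_
    rw [hdn]
    field_simp
  · refine ((hasDerivAt_am_mul_one_div hk hy).cos.hasDerivWithinAt.congr
      (fun z hz => (cn_mul_one_div hk hz).symm) (cn_mul_one_div hk hy).symm).congr_deriv ?_
    rw [← sn, sn_mul_one_div hk hy]
    ring

theorem hasDerivWithinAt_EJ_am (hk₀ : 0 ≤ k) (hy : y ∈ arguments k) :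
    HasDerivWithinAt (fun y => EJ (am y k) k) (dn y k ^ 2) (arguments k) y :=
  ((hasDerivAt_EJ (am y k) k).comp_hasDerivWithinAt y (hasDerivWithinAt_am hk₀ hy)).congr_deriv
    (sq (dn y k)).symm

theorem sin_two_mul_arcsin_mul_sn (hk₀ : 0 ≤ k) (hy : y ∈ arguments k) :
    sin (2 * arcsin (k * sn y k)) = 2 * k * sn y k * dn y k := by
  rw [sin_two_mul, sin_arcsin' (mul_sn_mem_Icc hk₀ hy), cos_arcsin, mul_pow, ← dn, ← mul_assoc]

theorem cos_two_mul_arcsin_mul_sn (y k : ℝ) :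
    cos (2 * arcsin (k * sn y k)) = 2 * dn y k ^ 2 - 1 := by
  rw [cos_two_mul, cos_arcsin, mul_pow, ← dn]

end JacobiFunctions

section Primitives

variable {a b k x : ℝ} {s : Set ℝ}

theorem hasDerivWithinAt_dn_affine (hk : 0 < k) (hb : b ≠ 0)
    (hs : MapsTo (fun x => a + b * x) s (arguments k)) (hx : x ∈ s) :
    HasDerivWithinAt (fun x => 2 / (b * k ^ 2) * dn (a + b * x) k)
      (-sin (2 * am (a + b * x) k)) s x := by
  refine ((hasDerivWithinAt_comp_affine (hasDerivWithinAt_dn hk.le (hs hx)) hs).const_mul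
    _).congr_deriv ?_
  rw [sin_two_mul, sn, cn]
  field_simp

theorem hasDerivWithinAt_EJ_am_affine (hk : 0 < k) (hb : b ≠ 0)
    (hs : MapsTo (fun x => a + b * x) s (arguments k)) (hx : x ∈ s) :
    HasDerivWithinAt (fun x => 2 / (b * k ^ 2) * EJ (am (a + b * x) k) k + x - 2 * x / k ^ 2)
      (cos (2 * am (a + b * x) k)) s x := by
  have hEJ := hasDerivWithinAt_comp_affine (hasDerivWithinAt_EJ_am hk.le (hs hx)) hs
  have hid := hasDerivWithinAt_id x s
  refine (((hEJ.const_mul (2 / (b * k ^ 2))).add hid).sub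
    ((hid.const_mul 2).div_const (k ^ 2))).congr_deriv ?_
  rw [dn_sq hk.le (hs hx), cos_two_mul_eq_one_sub, ← sn]
  field_simp
  ring

theorem hasDerivWithinAt_cn_affine (hk₀ : 0 ≤ k) (hb : b ≠ 0)
    (hs : MapsTo (fun x => a + b * x) s (arguments k)) (hx : x ∈ s) :
    HasDerivWithinAt (fun x => 2 * k / b * cn (a + b * x) k)
      (-sin (2 * arcsin (k * sn (a + b * x) k))) s x := by
  refine ((hasDerivWithinAt_comp_affine (hasDerivWithinAt_cn hk₀ (hs hx)) hs).const_mul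
    _).congr_deriv ?_
  rw [sin_two_mul_arcsin_mul_sn hk₀ (hs hx)]
  field_simp

theorem hasDerivWithinAt_EJ_am_affine_sub (hk₀ : 0 ≤ k) (hb : b ≠ 0)
    (hs : MapsTo (fun x => a + b * x) s (arguments k)) (hx : x ∈ s) :
    HasDerivWithinAt (fun x => 2 / b * EJ (am (a + b * x) k) k - x)
      (cos (2 * arcsin (k * sn (a + b * x) k))) s x := by
  refine (((hasDerivWithinAt_comp_affine (hasDerivWithinAt_EJ_am hk₀ (hs hx)) hs).const_mul
    (2 / b)).sub (hasDerivWithinAt_id x s)).congr_deriv ?_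
  rw [cos_two_mul_arcsin_mul_sn]
  field_simp

end Primitives

/-- The pendulum equation `θ'' = -b² k² sin θ cos θ` on `[0, L]` as a first order system for the
angle `θ` and the velocity `ω`. The energy `ω² + b² k² sin² θ` is prescribed as `b²` at `0`, and the
motion is monotone in the direction given by the sign of `b`. -/
structure IsMonotonePendulum (b k L : ℝ) (θ ω : ℝ → ℝ) : Prop where
  hasDerivWithinAt_angle : ∀ x ∈ Icc 0 L, HasDerivWithinAt θ (ω x) (Icc 0 L) x
  hasDerivWithinAt_velocity : ∀ x ∈ Icc 0 L,
    HasDerivWithinAt ω (-(b ^ 2 * k ^ 2 * sin (θ x) * cos (θ x))) (Icc 0 L) x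
  energy_zero : ω 0 ^ 2 = b ^ 2 * (1 - k ^ 2 * sin (θ 0) ^ 2)
  mul_velocity_nonneg : ∀ x ∈ Icc 0 L, 0 ≤ b * ω x

section Pendulum

variable {a b k L x : ℝ} {θ ω : ℝ → ℝ}

namespace IsMonotonePendulum

theorem continuousOn_angle (h : IsMonotonePendulum b k L θ ω) : ContinuousOn θ (Icc 0 L) :=
  fun x hx => (h.hasDerivWithinAt_angle x hx).continuousWithinAt

theorem energy (h : IsMonotonePendulum b k L θ ω) (hx : x ∈ Icc 0 L) :
    ω x ^ 2 = b ^ 2 * (1 - k ^ 2 * sin (θ x) ^ 2) := by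
  have hderiv : ∀ y ∈ Icc 0 L,
      HasDerivWithinAt (fun y => ω y ^ 2 + b ^ 2 * k ^ 2 * sin (θ y) ^ 2) 0 (Icc 0 L) y :=
    fun y hy => (((h.hasDerivWithinAt_velocity y hy).pow 2).add
      (((h.hasDerivWithinAt_angle y hy).sin.pow 2).const_mul (b ^ 2 * k ^ 2))).congr_deriv
        (by push_cast; ring)
  have hconst := eq_of_hasDerivWithinAt_zero (convex_Icc 0 L) hderiv hx
    (left_mem_Icc.2 (hx.1.trans hx.2))
  linear_combination hconst + h.energy_zero

theorem radicand_nonneg (h : IsMonotonePendulum b k L θ ω) (hb : b ≠ 0) (hx : x ∈ Icc 0 L) :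
    0 ≤ 1 - k ^ 2 * sin (θ x) ^ 2 :=
  (mul_nonneg_iff_of_pos_left (sq_pos_of_ne_zero hb)).1 (h.energy hx ▸ sq_nonneg (ω x))

theorem velocity_eq (h : IsMonotonePendulum b k L θ ω) (hb : b ≠ 0) (hx : x ∈ Icc 0 L) :
    ω x = b * √(1 - k ^ 2 * sin (θ x) ^ 2) := by
  have hnonneg : 0 ≤ b * (b * √(1 - k ^ 2 * sin (θ x) ^ 2)) := by
    rw [← mul_assoc]
    exact mul_nonneg (mul_self_nonneg b) (sqrt_nonneg _)
  have hsq : (b * ω x) ^ 2 = (b * (b * √(1 - k ^ 2 * sin (θ x) ^ 2))) ^ 2 := by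
    rw [mul_pow, mul_pow, mul_pow, sq_sqrt (h.radicand_nonneg hb hx), h.energy hx]
  exact mul_left_cancel₀ hb ((sq_eq_sq₀ (h.mul_velocity_nonneg x hx) hnonneg).1 hsq)

theorem cos_angle_ne_zero_of_one_lt (h : IsMonotonePendulum b k L θ ω) (hb : b ≠ 0) (hk : 1 < k)
    (hx : x ∈ Icc 0 L) : cos (θ x) ≠ 0 := fun hcos => by
  have hr := h.radicand_nonneg hb hx
  rw [sin_sq, hcos] at hr
  nlinarith

theorem cos_angle_ne_zero_of_modulus_one (h : IsMonotonePendulum b 1 L θ ω) (hb : b ≠ 0)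
    (h₀ : cos (θ 0) ≠ 0) (hx : x ∈ Icc 0 L) : cos (θ x) ≠ 0 := fun hcos => by
  have hlip : LipschitzWith (‖b‖₊ * (1 * 1)) fun t : ℝ => b * ‖cos t‖ :=
    (lipschitzWith_smul b).comp (lipschitzWith_one_norm.comp lipschitzWith_cos)
  have hsub : Icc 0 x ⊆ Icc 0 L := Icc_subset_Icc_right hx.2
  have hvel : ∀ t ∈ Icc 0 x, ω t = b * ‖cos (θ t)‖ := fun t ht => by
    rw [h.velocity_eq hb (hsub ht), one_pow, one_mul, ← cos_sq', sqrt_sq_eq_abs, norm_eq_abs]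
  have hconst : θ 0 = θ x := eq_of_autonomous_of_right_eq_zero hlip hx.1
    (fun t ht => ((h.hasDerivWithinAt_angle t (hsub ht)).mono hsub).congr_deriv (hvel t ht))
    (by rw [hcos, norm_zero, mul_zero])
  exact h₀ (hconst ▸ hcos)

theorem cos_angle_ne_zero (h : IsMonotonePendulum b k L θ ω) (hb : b ≠ 0) (hk : 1 ≤ k)
    (h₀ : θ 0 ∈ amplitudes k) (hx : x ∈ Icc 0 L) : cos (θ x) ≠ 0 := by
  rcases hk.eq_or_lt with rfl | hk
  · exact h.cos_angle_ne_zero_of_modulus_one hb (cos_pos_of_mem_Ioo (amplitudes_one ▸ h₀)).ne' hx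
  · exact h.cos_angle_ne_zero_of_one_lt hb hk hx

theorem angle_mem_amplitudes (h : IsMonotonePendulum b k L θ ω) (hb : b ≠ 0)
    (h₀ : θ 0 ∈ amplitudes k) (hx : x ∈ Icc 0 L) : θ x ∈ amplitudes k := by
  rcases lt_or_ge k 1 with hk | hk
  · exact mem_amplitudes_of_lt_one hk _
  · exact mem_amplitudes_of_abs_lt hk (abs_lt_pi_div_two_of_cos_ne_zero isPreconnected_Icc
      h.continuousOn_angle (fun y hy => h.cos_angle_ne_zero hb hk h₀ hy)
      (left_mem_Icc.2 (hx.1.trans hx.2)) (abs_le_pi_div_two_of_mem_amplitudes hk h₀) hx)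
      (h.radicand_nonneg hb hx)

theorem radicand_pos_of_cos_angle_ne_zero (h : IsMonotonePendulum b k L θ ω) (hb : b ≠ 0)
    (hx : x ∈ Ioo 0 L) (hcos : cos (θ x) ≠ 0) : 0 < 1 - k ^ 2 * sin (θ x) ^ 2 := by
  have hx' : x ∈ Icc 0 L := Ioo_subset_Icc_self hx
  have hnhds : Icc 0 L ∈ 𝓝 x := Icc_mem_nhds hx.1 hx.2
  refine (h.radicand_nonneg hb hx').lt_of_ne fun hr => ?_
  have hrest : ω x = 0 := by rw [h.velocity_eq hb hx', ← hr, sqrt_zero, mul_zero]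
  have hmin : IsLocalMin (fun y => b * ω y) x := by
    filter_upwards [hnhds] with y hy
    simpa only [hrest, mul_zero] using h.mul_velocity_nonneg y hy
  have hstationary := hmin.hasDerivAt_eq_zero
    (((h.hasDerivWithinAt_velocity x hx').hasDerivAt hnhds).const_mul b)
  have hk : k ≠ 0 := by rintro rfl; norm_num at hr
  have hsin : sin (θ x) ≠ 0 := fun hsin => by norm_num [hsin] at hr
  exact mul_ne_zero hb (neg_ne_zero.2 (mul_ne_zero (mul_ne_zero (mul_ne_zero (pow_ne_zero 2 hb)
    (pow_ne_zero 2 hk)) hsin) hcos)) hstationary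

theorem radicand_pos (h : IsMonotonePendulum b k L θ ω) (hk₀ : 0 ≤ k) (hb : b ≠ 0)
    (h₀ : θ 0 ∈ amplitudes k) (hx : x ∈ Ioo 0 L) : 0 < 1 - k ^ 2 * sin (θ x) ^ 2 := by
  have hx' : x ∈ Icc 0 L := Ioo_subset_Icc_self hx
  rcases le_or_gt k 1 with hk | hk
  · exact radicand_pos_of_le_one hk₀ hk (h.angle_mem_amplitudes hb h₀ hx')
  · exact h.radicand_pos_of_cos_angle_ne_zero hb hx (h.cos_angle_ne_zero hb hk.le h₀ hx')

theorem hasDerivAt_FJ_angle (h : IsMonotonePendulum b k L θ ω) (hk₀ : 0 ≤ k) (hb : b ≠ 0)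
    (h₀ : θ 0 ∈ amplitudes k) (hx : x ∈ Ioo 0 L) :
    HasDerivAt (fun x => FJ (θ x) k) b x := by
  have hx' : x ∈ Icc 0 L := Ioo_subset_Icc_self hx
  have hpos := h.radicand_pos hk₀ hb h₀ hx
  have hFJ := (hasStrictDerivAt_FJ hk₀ (h.angle_mem_amplitudes hb h₀ hx') hpos).hasDerivAt
  have hangle := (h.hasDerivWithinAt_angle x hx').hasDerivAt (Icc_mem_nhds hx.1 hx.2)
  refine (HasDerivAt.comp x hFJ hangle).congr_deriv ?_
  rw [h.velocity_eq hb hx', one_div_mul_eq_div, mul_div_cancel_right₀ _ (sqrt_pos.2 hpos).ne']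

theorem FJ_angle (h : IsMonotonePendulum b k L θ ω) (hk₀ : 0 ≤ k) (hb : b ≠ 0)
    (h₀ : θ 0 ∈ amplitudes k) (hx : x ∈ Icc 0 L) : FJ (θ x) k = FJ (θ 0) k + b * x := by
  rcases hx.1.eq_or_lt with rfl | hx₀
  · rw [mul_zero, add_zero]
  have hcont : ContinuousOn (fun x => FJ (θ x) k) (Icc 0 x) :=
    ((continuousOn_FJ hk₀).comp h.continuousOn_angle
      fun y hy => h.angle_mem_amplitudes hb h₀ hy).mono (Icc_subset_Icc_right hx.2)
  obtain ⟨-, -, hslope⟩ := exists_hasDerivAt_eq_slope _ (fun _ => b) hx₀ hcont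
    fun y hy => h.hasDerivAt_FJ_angle hk₀ hb h₀ ⟨hy.1, hy.2.trans_le hx.2⟩
  rw [sub_zero, eq_div_iff hx₀.ne'] at hslope
  linarith

end IsMonotonePendulum

theorem isMonotonePendulum_of_eq_am (hk₀ : 0 ≤ k) (hL : 0 ≤ L)
    (h : ∀ x ∈ Icc 0 L, a + b * x ∈ arguments k ∧ θ x = am (a + b * x) k) :
    IsMonotonePendulum b k L θ fun x => b * dn (a + b * x) k := by
  have hmaps : MapsTo (fun x => a + b * x) (Icc 0 L) (arguments k) := fun x hx => (h x hx).1
  refine ⟨fun x hx => ?_, fun x hx => ?_, ?_, fun x _ => ?_⟩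
  · exact ((hasDerivWithinAt_comp_affine (hasDerivWithinAt_am hk₀ (hmaps hx)) hmaps).congr
      (fun y hy => (h y hy).2) (h x hx).2).congr_deriv (mul_comm _ _)
  · refine ((hasDerivWithinAt_comp_affine (hasDerivWithinAt_dn hk₀ (hmaps hx)) hmaps).const_mul
      b).congr_deriv ?_
    rw [(h x hx).2, sn, cn]
    ring
  · have h₀ := left_mem_Icc.2 hL
    rw [mul_pow, dn_sq hk₀ (hmaps h₀), (h 0 h₀).2, sn]
  · rw [← mul_assoc]
    exact mul_nonneg (mul_self_nonneg b) (dn_nonneg _ k)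

theorem exists_isMonotonePendulum_iff {θ₀ : ℝ} (hk₀ : 0 ≤ k) (hb : b ≠ 0) (hL : 0 ≤ L)
    (h₀ : θ₀ ∈ amplitudes k) :
    (θ 0 = θ₀ ∧ ∃ ω, IsMonotonePendulum b k L θ ω) ↔
      ∀ x ∈ Icc 0 L, FJ θ₀ k + b * x ∈ arguments k ∧ θ x = am (FJ θ₀ k + b * x) k := by
  constructor
  · rintro ⟨rfl, ω, h⟩ x hx
    have hmem := h.angle_mem_amplitudes hb h₀ hx
    rw [← h.FJ_angle hk₀ hb h₀ hx, am_FJ hk₀ hmem]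
    exact ⟨mem_image_of_mem _ hmem, rfl⟩
  · intro h
    refine ⟨?_, _, isMonotonePendulum_of_eq_am hk₀ hL h⟩
    rw [(h 0 (left_mem_Icc.2 hL)).2, mul_zero, add_zero, am_FJ hk₀ h₀]

end Pendulum

theorem isDisplacement_iff {L : ℝ} {φ f g : ℝ → ℝ}
    (hf : ∀ x ∈ Icc 0 L, HasDerivWithinAt f (cos (φ x) - 1) (Icc 0 L) x)
    (hg : ∀ x ∈ Icc 0 L, HasDerivWithinAt g (-sin (φ x)) (Icc 0 L) x) (u w : ℝ → ℝ) :
    IsDisplacement L φ u w ↔ ∃ Cu Cw, ∀ x ∈ Icc 0 L, u x = Cu + f x ∧ w x = Cw + g x := by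
  have hu := forall_hasDerivWithinAt_iff_exists_eq_const_add (convex_Icc 0 L) hf u
  have hw := forall_hasDerivWithinAt_iff_exists_eq_const_add (convex_Icc 0 L) hg w
  simp only [IsDisplacement, forall_and, hu, hw, exists_and_left, exists_and_right]

theorem isDisplacement_iff_of_primitives {L : ℝ} {φ p q : ℝ → ℝ} (α : ℝ)
    (hp : ∀ x ∈ Icc 0 L, HasDerivWithinAt p (-sin (φ x + α)) (Icc 0 L) x)
    (hq : ∀ x ∈ Icc 0 L, HasDerivWithinAt q (cos (φ x + α)) (Icc 0 L) x) (u w : ℝ → ℝ) :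
    IsDisplacement L φ u w ↔ ∃ Cu Cw : ℝ, ∀ x ∈ Icc 0 L,
      u x = Cu - x - p x * sin α + q x * cos α ∧ w x = Cw + p x * cos α + q x * sin α := by
  have hf : ∀ x ∈ Icc 0 L, HasDerivWithinAt (fun x => q x * cos α - p x * sin α - x)
      (cos (φ x) - 1) (Icc 0 L) x := fun x hx => by
    refine ((((hq x hx).mul_const _).sub ((hp x hx).mul_const _)).sub
      (hasDerivWithinAt_id x _)).congr_deriv ?_
    rw [neg_mul, sub_neg_eq_add, ← cos_sub, add_sub_cancel_right]
  have hg : ∀ x ∈ Icc 0 L, HasDerivWithinAt (fun x => p x * cos α + q x * sin α)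
      (-sin (φ x)) (Icc 0 L) x := fun x hx => by
    refine (((hp x hx).mul_const _).add ((hq x hx).mul_const _)).congr_deriv ?_
    rw [neg_mul, neg_add_eq_sub, ← neg_sub, ← sin_sub, add_sub_cancel_right]
  rw [isDisplacement_iff hf hg]
  refine exists₂_congr fun Cu Cw => forall₂_congr fun x _ => ?_
  rw [add_assoc Cw, show Cu + (q x * cos α - p x * sin α - x) =
    Cu - x - p x * sin α + q x * cos α by ring]

namespace EndData

/-- The end data for which the rotation of the beam is not constant: the standing assumption of
the solution formulas, positivity of the bending stiffness included. -/
structure IsNondegenerate (d : EndData) : Prop where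
  EI_pos : 0 < d.EI
  moment_or_shear : d.M ≠ 0 ∨ d.X * sin d.φa + d.Z * cos d.φa ≠ 0

variable {d : EndData} {α L : ℝ} {φ : ℝ → ℝ}

theorem F_nonneg (d : EndData) : 0 ≤ d.F := sqrt_nonneg _

theorem F_sq (d : EndData) : d.F ^ 2 = d.X ^ 2 + d.Z ^ 2 := sq_sqrt (by positivity)

theorem k_nonneg (d : EndData) : 0 ≤ d.k := sqrt_nonneg _

theorem A_nonneg (hEI : 0 < d.EI) : 0 ≤ d.A :=
  div_nonneg (mul_nonneg two_pos.le d.F_nonneg) hEI.le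

theorem exists_isPhase (d : EndData) : ∃ α, d.IsPhase α := by
  let force : ℂ := ⟨d.X, d.Z⟩
  have hnorm : ‖force‖ = d.F := Complex.norm_eq_sqrt_sq_add_sq force
  let angle : Real.Angle := d.φa + force.arg
  have hangle : ((angle.toReal - d.φa : ℝ) : Real.Angle) = (force.arg : Real.Angle) := by
    rw [Real.Angle.coe_sub, Real.Angle.coe_toReal, add_sub_cancel_left]
  refine ⟨angle.toReal - d.φa, ?_, ?_, fun _ => ?_⟩
  · rw [← Real.Angle.cos_coe, hangle, Real.Angle.cos_coe, ← hnorm, Complex.norm_mul_cos_arg]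
  · rw [← Real.Angle.sin_coe, hangle, Real.Angle.sin_coe, ← hnorm, Complex.norm_mul_sin_arg]
  · rw [add_sub_cancel]
    exact angle.abs_toReal_le_pi

theorem isPhase_arctan (hX : 0 < d.X) (h : 1 ≤ d.k → |d.φa + arctan (d.Z / d.X)| ≤ π) :
    d.IsPhase (arctan (d.Z / d.X)) := by
  have hF : 0 < d.F := sqrt_pos.2 (by positivity)
  have hsqrt : √(1 + (d.Z / d.X) ^ 2) = d.F / d.X := by
    rw [sqrt_eq_iff_mul_self_eq_of_pos (by positivity), ← sq, div_pow, F_sq]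
    field_simp
  refine ⟨?_, ?_, h⟩
  · rw [cos_arctan, hsqrt]
    field_simp
  · rw [sin_arctan, hsqrt]
    field_simp

theorem IsPhase.force_eq (hα : d.IsPhase α) (x : ℝ) :
    d.X * sin x + d.Z * cos x = d.F * sin (x + α) := by
  rw [← hα.cos_eq, ← hα.sin_eq, sin_add]
  ring

theorem IsPhase.N_eq (hα : d.IsPhase α) : d.N = -d.F * cos (d.φa + α) := by
  rw [N, ← hα.cos_eq, ← hα.sin_eq, cos_add]
  ring

theorem IsPhase.c₁_add_A (hα : d.IsPhase α) :
    d.c₁ + d.A = d.κa ^ 2 + 2 * d.A * sin ((d.φa + α) / 2) ^ 2 := by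
  rw [c₁, A, hα.N_eq, cos_eq_one_sub_two_mul_sin_half_sq]
  ring

theorem IsNondegenerate.shear_ne_zero (h : d.IsNondegenerate) (hκ : d.κa = 0) :
    d.X * sin d.φa + d.Z * cos d.φa ≠ 0 :=
  h.moment_or_shear.resolve_left fun hM =>
    hM (neg_eq_zero.1 ((div_eq_zero_iff.1 hκ).resolve_right h.EI_pos.ne'))

theorem IsNondegenerate.c₁_add_A_pos (h : d.IsNondegenerate) : 0 < d.c₁ + d.A := by
  obtain ⟨α, hα⟩ := d.exists_isPhase
  have hA := A_nonneg h.EI_pos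
  rw [hα.c₁_add_A]
  rcases eq_or_ne d.κa 0 with hκ | hκ
  · have hshear := h.shear_ne_zero hκ
    rw [hα.force_eq, sin_eq_two_mul_sin_half_mul_cos_half] at hshear
    have hA_ne : d.A ≠ 0 :=
      div_ne_zero (mul_ne_zero two_ne_zero (left_ne_zero_of_mul hshear)) h.EI_pos.ne'
    have hsin : sin ((d.φa + α) / 2) ≠ 0 :=
      right_ne_zero_of_mul (left_ne_zero_of_mul (right_ne_zero_of_mul hshear))
    positivity
  · positivity

theorem k_eq (hEI : d.EI ≠ 0) : d.k = √(4 * d.F / (2 * (d.F + d.N) + d.EI * d.κa ^ 2)) := by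
  have hnum : 4 * d.F = d.EI * (2 * d.A) := by
    rw [A]
    field_simp
    ring
  have hden : 2 * (d.F + d.N) + d.EI * d.κa ^ 2 = d.EI * (d.c₁ + d.A) := by
    rw [c₁, A]
    field_simp
    ring
  rw [k, hnum, hden, mul_div_mul_left _ _ hEI]

theorem F_pos_of_one_lt_k (hk : 1 < d.k) : 0 < d.F :=
  d.F_nonneg.lt_of_ne fun hF => by
    rw [k, A, ← hF, mul_zero, zero_div, mul_zero, zero_div, sqrt_zero] at hk
    exact hk.not_gt one_pos

theorem IsPhase.one_lt_k_iff (hα : d.IsPhase α) (h : d.IsNondegenerate) :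
    1 < d.k ↔ d.M ^ 2 / d.EI < 2 * d.F * (1 + cos (d.φa + α)) := by
  have hEI := h.EI_pos
  have hlhs : d.EI * (d.c₁ + d.A) = d.M ^ 2 / d.EI + 2 * d.F * (1 - cos (d.φa + α)) := by
    rw [hα.c₁_add_A, κa, A, cos_eq_one_sub_two_mul_sin_half_sq]
    field_simp
    ring
  have hrhs : d.EI * (2 * d.A) = 4 * d.F := by
    rw [A]
    field_simp
    ring
  rw [k, lt_sqrt zero_le_one, one_pow, one_lt_div h.c₁_add_A_pos, ← mul_lt_mul_iff_right₀ hEI,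
    hlhs, hrhs]
  constructor <;> intro <;> linarith

theorem curvSign_mul_κa_pos (hκ : d.κa ≠ 0) : 0 < d.curvSign * d.κa := by
  rw [curvSign, if_pos hκ]
  exact sign_mul_pos_of_ne_zero _ hκ

theorem curvSign_mul_κa_nonneg (d : EndData) : 0 ≤ d.curvSign * d.κa := by
  rcases eq_or_ne d.κa 0 with hκ | hκ
  · rw [hκ, mul_zero]
  · exact (curvSign_mul_κa_pos hκ).le

namespace IsNondegenerate

theorem curvSign_mul_neg_shear_pos (h : d.IsNondegenerate) (hκ : d.κa = 0) :
    0 < d.curvSign * -(d.X * sin d.φa + d.Z * cos d.φa) := by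
  rw [curvSign, if_neg (not_not.2 hκ)]
  exact sign_mul_pos_of_ne_zero _ (neg_ne_zero.2 (h.shear_ne_zero hκ))

theorem curvSign_sq (h : d.IsNondegenerate) : d.curvSign ^ 2 = 1 := by
  have hsign : ∀ {y : ℝ}, y ≠ 0 → Real.sign y ^ 2 = 1 := fun hy =>
    sq_eq_one_iff.2 (sign_apply_eq_of_ne_zero _ hy).symm
  rw [curvSign]
  split_ifs with hκ
  · exact hsign hκ
  · exact hsign (neg_ne_zero.2 (h.shear_ne_zero (not_not.1 hκ)))

theorem four_mul_b_sq (h : d.IsNondegenerate) : 4 * d.b ^ 2 = d.c₁ + d.A := by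
  rw [b, mul_pow, h.curvSign_sq, div_pow, sq_sqrt h.c₁_add_A_pos.le]
  ring

theorem b_ne_zero (h : d.IsNondegenerate) : d.b ≠ 0 := fun hb => by
  have hpos := h.c₁_add_A_pos
  rw [← h.four_mul_b_sq, hb] at hpos
  norm_num at hpos

theorem k_sq_mul (h : d.IsNondegenerate) : d.k ^ 2 * (d.c₁ + d.A) = 2 * d.A := by
  rw [k, sq_sqrt (div_nonneg (mul_nonneg two_pos.le (A_nonneg h.EI_pos)) h.c₁_add_A_pos.le),
    div_mul_cancel₀ _ h.c₁_add_A_pos.ne']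

theorem k_pos (h : d.IsNondegenerate) (hF : 0 < d.F) : 0 < d.k := by
  have hEI := h.EI_pos
  exact sqrt_pos.2 (div_pos (by rw [A]; positivity) h.c₁_add_A_pos)

theorem b_sq_mul_k_sq (h : d.IsNondegenerate) : d.b ^ 2 * d.k ^ 2 = d.F / d.EI := by
  have hk := h.k_sq_mul
  rw [← h.four_mul_b_sq, A] at hk
  linear_combination hk / 4

end IsNondegenerate

theorem IsPhase.κa_sq (hα : d.IsPhase α) (h : d.IsNondegenerate) :
    d.κa ^ 2 = 4 * d.b ^ 2 * (1 - d.k ^ 2 * sin ((d.φa + α) / 2) ^ 2) := by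
  rw [h.four_mul_b_sq]
  linear_combination sin ((d.φa + α) / 2) ^ 2 * h.k_sq_mul - hα.c₁_add_A

theorem IsPhase.initial_radicand_nonneg (hα : d.IsPhase α) (h : d.IsNondegenerate) :
    0 ≤ 1 - d.k ^ 2 * sin ((d.φa + α) / 2) ^ 2 := by
  have hb := h.b_ne_zero
  exact (mul_nonneg_iff_of_pos_left (by positivity)).1 (hα.κa_sq h ▸ sq_nonneg d.κa)

theorem IsPhase.cos_initial_ne_zero (hα : d.IsPhase α) (h : d.IsNondegenerate) (hk : 1 ≤ d.k) :
    cos ((d.φa + α) / 2) ≠ 0 := fun hcos => by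
  have hsin : sin ((d.φa + α) / 2) ^ 2 = 1 := by rw [sin_sq, hcos, zero_pow two_ne_zero, sub_zero]
  have hradicand : 1 - d.k ^ 2 * sin ((d.φa + α) / 2) ^ 2 = 0 := by
    refine le_antisymm ?_ (hα.initial_radicand_nonneg h)
    rw [hsin, mul_one]
    exact sub_nonpos.2 (one_le_pow₀ hk)
  have hκ : d.κa = 0 := by
    rw [← sq_eq_zero_iff, hα.κa_sq h, hradicand, mul_zero]
  apply h.shear_ne_zero hκ
  rw [hα.force_eq, sin_eq_two_mul_sin_half_mul_cos_half, hcos, mul_zero, mul_zero]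

theorem IsPhase.initial_mem_amplitudes (hα : d.IsPhase α) (h : d.IsNondegenerate) :
    (d.φa + α) / 2 ∈ amplitudes d.k := by
  rcases lt_or_ge d.k 1 with hk | hk
  · exact mem_amplitudes_of_lt_one hk _
  have hle : |(d.φa + α) / 2| ≤ π / 2 := by
    rw [abs_div, abs_two]
    exact div_le_div_of_nonneg_right (hα.branch hk) two_pos.le
  have hne : |(d.φa + α) / 2| ≠ π / 2 := fun heq =>
    hα.cos_initial_ne_zero h hk (by rw [← cos_abs, heq, cos_pi_div_two])
  exact mem_amplitudes_of_abs_lt hk (hle.lt_of_ne hne) (hα.initial_radicand_nonneg h)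

theorem b_mul_nonneg {y : ℝ} (hy : 0 ≤ d.curvSign * y) : 0 ≤ d.b * y := by
  rw [b, mul_assoc]
  exact mul_nonneg (by positivity) hy

theorem IsPhase.equilibrium_iff (hα : d.IsPhase α) (h : d.IsNondegenerate) (ψ κ' : ℝ) :
    d.EI * κ' + d.X * sin ψ + d.Z * cos ψ = 0 ↔
      κ' / 2 = -(d.b ^ 2 * d.k ^ 2 * sin ((ψ + α) / 2) * cos ((ψ + α) / 2)) := by
  have hEI := h.EI_pos.ne'
  rw [add_assoc, hα.force_eq, h.b_sq_mul_k_sq, sin_eq_two_mul_sin_half_mul_cos_half]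
  constructor <;> intro heq
  · field_simp
    linear_combination heq
  · field_simp at heq
    linear_combination heq

theorem IsNondegenerate.exists_curvSign_mul_pos (h : d.IsNondegenerate) (hL : 0 < L)
    {κ : ℝ → ℝ} {κ'₀ : ℝ} (hκ₀ : κ 0 = d.κa) (hκ : HasDerivWithinAt κ κ'₀ (Icc 0 L) 0)
    (hode : d.EI * κ'₀ + d.X * sin d.φa + d.Z * cos d.φa = 0) :
    ∃ y ∈ Icc 0 L, 0 < d.curvSign * κ y := by
  rcases eq_or_ne d.κa 0 with hκa | hκa
  · refine exists_pos_of_hasDerivWithinAt_pos hL (hκ.const_mul d.curvSign)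
      (by rw [hκ₀, hκa, mul_zero]) ?_
    have hpos := h.curvSign_mul_neg_shear_pos hκa
    rw [show -(d.X * sin d.φa + d.Z * cos d.φa) = d.EI * κ'₀ by linarith, mul_left_comm] at hpos
    exact (mul_pos_iff_of_pos_left h.EI_pos).1 hpos
  · exact ⟨0, left_mem_Icc.2 hL.le, hκ₀ ▸ curvSign_mul_κa_pos hκa⟩

theorem IsPhase.exists_isMonotonePendulum (hα : d.IsPhase α) (h : d.IsNondegenerate) (hL : 0 < L)
    (hφ : d.IsRotation L φ) :
    ∃ ω, IsMonotonePendulum d.b d.k L (fun x => (φ x + α) / 2) ω := by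
  obtain ⟨κ, κ', hφ₀, hκ₀, hφ, hκ, hode, hsign⟩ := hφ
  have hL₀ := left_mem_Icc.2 hL.le
  obtain ⟨y, hy, hpos⟩ := h.exists_curvSign_mul_pos hL hκ₀ (hκ 0 hL₀) (hφ₀ ▸ hode 0 hL₀)
  have hnonneg : ∀ x ∈ Icc 0 L, 0 ≤ d.curvSign * κ x := fun x hx => by
    refine nonneg_of_mul_nonneg_left ?_ hpos
    rw [mul_mul_mul_comm]
    exact mul_nonneg (mul_self_nonneg _) (hsign x hx y hy)
  refine ⟨fun x => κ x / 2, fun x hx => ((hφ x hx).add_const α).div_const 2, fun x hx => ?_, ?_,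
    fun x hx => ?_⟩
  · exact ((hκ x hx).div_const 2).congr_deriv ((hα.equilibrium_iff h _ _).1 (hode x hx))
  · have hκa : κ 0 = d.κa := hκ₀
    rw [hφ₀, hκa]
    linear_combination hα.κa_sq h / 4
  · rw [mul_div_assoc']
    exact div_nonneg (b_mul_nonneg (hnonneg x hx)) two_pos.le

theorem IsPhase.isRotation_of_isMonotonePendulum (hα : d.IsPhase α) (h : d.IsNondegenerate)
    (hφ₀ : φ 0 = d.φa) {ω : ℝ → ℝ} (hL : 0 ≤ L)
    (hω : IsMonotonePendulum d.b d.k L (fun x => (φ x + α) / 2) ω) : d.IsRotation L φ := by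
  have hb := h.b_ne_zero
  have hω₀ : 2 * ω 0 = d.κa := by
    have hsq : (d.b * (2 * ω 0)) ^ 2 = (d.b * d.κa) ^ 2 := by
      have henergy := hω.energy_zero
      rw [hφ₀] at henergy
      rw [mul_pow, mul_pow d.b, mul_pow, henergy, hα.κa_sq h]
      ring
    refine mul_left_cancel₀ hb ((sq_eq_sq₀ ?_ (b_mul_nonneg d.curvSign_mul_κa_nonneg)).1 hsq)
    rw [mul_left_comm]
    exact mul_nonneg two_pos.le (hω.mul_velocity_nonneg 0 (left_mem_Icc.2 hL))
  refine ⟨fun x => 2 * ω x, _, hφ₀, hω₀, fun x hx => ?_,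
    fun x hx => (hω.hasDerivWithinAt_velocity x hx).const_mul 2,
    fun x _ => (hα.equilibrium_iff h _ _).2 (mul_div_cancel_left₀ _ two_ne_zero),
    fun x hx y hy => ?_⟩
  · have hangle := ((hω.hasDerivWithinAt_angle x hx).const_mul 2).sub_const α
    simpa only [mul_div_cancel₀ _ (two_ne_zero' ℝ), add_sub_cancel_right] using hangle
  · have hprod := mul_nonneg (hω.mul_velocity_nonneg x hx) (hω.mul_velocity_nonneg y hy)
    rw [mul_mul_mul_comm] at hprod
    have hvel : 0 ≤ ω x * ω y := (mul_nonneg_iff_of_pos_left (mul_self_pos.2 hb)).1 hprod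
    rw [mul_mul_mul_comm]
    exact mul_nonneg (mul_self_nonneg 2) hvel

theorem IsPhase.isRotation_iff_exists_isMonotonePendulum (hα : d.IsPhase α)
    (h : d.IsNondegenerate) (hL : 0 < L) :
    d.IsRotation L φ ↔
      φ 0 = d.φa ∧ ∃ ω, IsMonotonePendulum d.b d.k L (fun x => (φ x + α) / 2) ω :=
  ⟨fun hφ => ⟨hφ.choose_spec.choose_spec.1, hα.exists_isMonotonePendulum h hL hφ⟩,
    fun ⟨hφ₀, _, hω⟩ => hα.isRotation_of_isMonotonePendulum h hφ₀ hL.le hω⟩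

theorem IsPhase.isRotation_iff (hα : d.IsPhase α) (h : d.IsNondegenerate) (hL : 0 < L)
    (φ : ℝ → ℝ) :
    d.IsRotation L φ ↔ ∀ x ∈ Icc 0 L, d.a α + d.b * x ∈ arguments d.k ∧
      φ x = 2 * am (d.a α + d.b * x) d.k - α := by
  have hinitial : φ 0 = d.φa ↔ (φ 0 + α) / 2 = (d.φa + α) / 2 := by
    rw [div_left_inj' two_ne_zero, add_left_inj]
  rw [hα.isRotation_iff_exists_isMonotonePendulum h hL, hinitial,
    exists_isMonotonePendulum_iff (θ := fun x => (φ x + α) / 2) d.k_nonneg h.b_ne_zero hL.le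
      (hα.initial_mem_amplitudes h), ← a]
  refine forall₂_congr fun x _ => and_congr_right fun _ => ?_
  rw [div_eq_iff two_ne_zero, mul_comm, eq_sub_iff_add_eq]

theorem IsPhase.isDisplacement_iff (hα : d.IsPhase α) (h : d.IsNondegenerate) (hL : 0 < L)
    (hF : 0 < d.F) (hφ : d.IsRotation L φ) (u w : ℝ → ℝ) :
    IsDisplacement L φ u w ↔ ∃ Cu Cw : ℝ, ∀ x ∈ Icc 0 L,
      u x = Cu - x - 2 / (d.b * d.k ^ 2) * dn (d.a α + d.b * x) d.k * sin α
        + (2 / (d.b * d.k ^ 2) * EJ (am (d.a α + d.b * x) d.k) d.k + x - 2 * x / d.k ^ 2)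
          * cos α ∧
      w x = Cw + 2 / (d.b * d.k ^ 2) * dn (d.a α + d.b * x) d.k * cos α
        + (2 / (d.b * d.k ^ 2) * EJ (am (d.a α + d.b * x) d.k) d.k + x - 2 * x / d.k ^ 2)
          * sin α := by
  have hsol := (hα.isRotation_iff h hL φ).1 hφ
  have hmaps : MapsTo (fun x => d.a α + d.b * x) (Icc 0 L) (arguments d.k) :=
    fun x hx => (hsol x hx).1
  have hangle : ∀ x ∈ Icc 0 L, φ x + α = 2 * am (d.a α + d.b * x) d.k :=
    fun x hx => eq_sub_iff_add_eq.1 (hsol x hx).2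
  exact isDisplacement_iff_of_primitives α
    (fun x hx => hangle x hx ▸ hasDerivWithinAt_dn_affine (h.k_pos hF) h.b_ne_zero hmaps hx)
    (fun x hx => hangle x hx ▸ hasDerivWithinAt_EJ_am_affine (h.k_pos hF) h.b_ne_zero hmaps hx) u w

theorem IsPhase.ktil_eq (hα : d.IsPhase α) (hEI : d.EI ≠ 0) (hF : d.F ≠ 0) :
    d.ktil = √(sin ((d.φa + α) / 2) ^ 2 + d.M ^ 2 / (4 * d.EI * d.F)) := by
  have hradicand : (d.c₁ + d.A) / (2 * d.A) =
      sin ((d.φa + α) / 2) ^ 2 + d.M ^ 2 / (4 * d.EI * d.F) := by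
    rw [hα.c₁_add_A, κa, A]
    field_simp
    ring
  rw [ktil, k, one_div, ← sqrt_inv, inv_div, hradicand]

theorem IsPhase.atil_eq (hα : d.IsPhase α) (h : d.IsNondegenerate) (hk : 1 < d.k) :
    d.atil α = FJ (arcsin (1 / d.ktil * sin ((d.φa + α) / 2))) d.ktil := by
  rw [atil, a, mul_FJ_eq_FJ_arcsin_mul_sin hk (hα.initial_mem_amplitudes h), ktil, one_div_one_div]

theorem IsNondegenerate.btil_eq (h : d.IsNondegenerate) :
    d.btil = √(d.F / d.EI) * d.curvSign := by
  have hsq : d.F / d.EI = (d.k * (√(d.c₁ + d.A) / 2)) ^ 2 := by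
    rw [mul_pow, div_pow, sq_sqrt h.c₁_add_A_pos.le, mul_div_assoc', h.k_sq_mul, A]
    ring
  rw [hsq, sqrt_sq (mul_nonneg d.k_nonneg (by positivity)), btil, b, mul_assoc]

theorem IsNondegenerate.btil_ne_zero (h : d.IsNondegenerate) (hF : 0 < d.F) : d.btil ≠ 0 :=
  mul_ne_zero (h.k_pos hF).ne' h.b_ne_zero

theorem atil_add_btil_mul (d : EndData) (α x : ℝ) :
    d.atil α + d.btil * x = d.k * (d.a α + d.b * x) := by
  rw [atil, btil, mul_add, mul_assoc]

theorem IsPhase.isRotation_iff_ktil (hα : d.IsPhase α) (h : d.IsNondegenerate) (hL : 0 < L)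
    (hk : 1 < d.k) (φ : ℝ → ℝ) :
    d.IsRotation L φ ↔ ∀ x ∈ Icc 0 L, |d.atil α + d.btil * x| ≤ K d.ktil ∧
      φ x = 2 * arcsin (d.ktil * sn (d.atil α + d.btil * x) d.ktil) - α := by
  rw [hα.isRotation_iff h hL]
  refine forall₂_congr fun x _ => ?_
  rw [atil_add_btil_mul, ktil, ← mem_arguments_iff_abs_mul_le_K hk]
  exact and_congr_right fun hx => by rw [am_eq_arcsin_one_div_mul_sn hk hx]

theorem IsPhase.isDisplacement_iff_ktil (hα : d.IsPhase α) (h : d.IsNondegenerate) (hL : 0 < L)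
    (hk : 1 < d.k) (hφ : d.IsRotation L φ) (u w : ℝ → ℝ) :
    IsDisplacement L φ u w ↔ ∃ Cu Cw : ℝ, ∀ x ∈ Icc 0 L,
      u x = Cu - x - 2 * d.ktil / d.btil * cn (d.atil α + d.btil * x) d.ktil * sin α
        + (2 / d.btil * EJ (am (d.atil α + d.btil * x) d.ktil) d.ktil - x) * cos α ∧
      w x = Cw + 2 * d.ktil / d.btil * cn (d.atil α + d.btil * x) d.ktil * cos α
        + (2 / d.btil * EJ (am (d.atil α + d.btil * x) d.ktil) d.ktil - x) * sin α := by
  have hsol := (hα.isRotation_iff_ktil h hL hk φ).1 hφ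
  have hmaps : MapsTo (fun x => d.atil α + d.btil * x) (Icc 0 L) (arguments d.ktil) :=
    fun x hx => (d.atil_add_btil_mul α x).symm.subst
      (mul_mem_arguments_one_div hk ((hα.isRotation_iff h hL φ).1 hφ x hx).1)
  have hangle : ∀ x ∈ Icc 0 L,
      φ x + α = 2 * arcsin (d.ktil * sn (d.atil α + d.btil * x) d.ktil) :=
    fun x hx => eq_sub_iff_add_eq.1 (hsol x hx).2
  have hk₀ : 0 ≤ d.ktil := one_div_nonneg_of_one_lt hk
  have hb := h.btil_ne_zero (F_pos_of_one_lt_k hk)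
  exact isDisplacement_iff_of_primitives α
    (fun x hx => hangle x hx ▸ hasDerivWithinAt_cn_affine hk₀ hb hmaps hx)
    (fun x hx => hangle x hx ▸ hasDerivWithinAt_EJ_am_affine_sub hk₀ hb hmaps hx) u w

end EndData

end InextensibleBeam

theorem mainTheorem2 (d : EndData) (hEI : 0 < d.EI) (L : ℝ) (hL : 0 < L)
    (hd : d.M ≠ 0 ∨ d.X * Real.sin d.φa + d.Z * Real.cos d.φa ≠ 0) :
    -- the phase angle
    (∃ α, d.IsPhase α) ∧
    (0 < d.X → (1 ≤ d.k → |d.φa + Real.arctan (d.Z / d.X)| ≤ Real.pi) →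
      d.IsPhase (Real.arctan (d.Z / d.X))) ∧
    -- the modulus
    0 < d.c₁ + d.A ∧
    d.k = Real.sqrt (4 * d.F / (2 * (d.F + d.N) + d.EI * d.κa ^ 2)) ∧
    ∀ α, d.IsPhase α →
      (1 < d.k ↔ d.M ^ 2 / d.EI < 2 * d.F * (1 + Real.cos (d.φa + α))) ∧
      -- rotation
      (∀ φ : ℝ → ℝ, d.IsRotation L φ ↔
        ∀ x ∈ Set.Icc 0 L, d.a α + d.b * x ∈ arguments d.k ∧
          φ x = 2 * am (d.a α + d.b * x) d.k - α) ∧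
      -- displacements
      (0 < d.F → ∀ φ : ℝ → ℝ, d.IsRotation L φ → ∀ u w : ℝ → ℝ,
        (IsDisplacement L φ u w ↔ ∃ Cu Cw : ℝ, ∀ x ∈ Set.Icc 0 L,
          u x = Cu - x - 2 / (d.b * d.k ^ 2) * dn (d.a α + d.b * x) d.k * Real.sin α
            + (2 / (d.b * d.k ^ 2) * EJ (am (d.a α + d.b * x) d.k) d.k + x - 2 * x / d.k ^ 2)
              * Real.cos α ∧
          w x = Cw + 2 / (d.b * d.k ^ 2) * dn (d.a α + d.b * x) d.k * Real.cos α
            + (2 / (d.b * d.k ^ 2) * EJ (am (d.a α + d.b * x) d.k) d.k + x - 2 * x / d.k ^ 2)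
              * Real.sin α)) ∧
      -- the form with the reciprocal modulus
      (1 < d.k →
        d.ktil = Real.sqrt (Real.sin ((d.φa + α) / 2) ^ 2 + d.M ^ 2 / (4 * d.EI * d.F)) ∧
        d.atil α = FJ (Real.arcsin (1 / d.ktil * Real.sin ((d.φa + α) / 2))) d.ktil ∧
        d.btil = Real.sqrt (d.F / d.EI) * d.curvSign ∧
        (∀ φ : ℝ → ℝ, d.IsRotation L φ ↔
          ∀ x ∈ Set.Icc 0 L, |d.atil α + d.btil * x| ≤ K d.ktil ∧
            φ x = 2 * Real.arcsin (d.ktil * sn (d.atil α + d.btil * x) d.ktil) - α) ∧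
        (∀ φ : ℝ → ℝ, d.IsRotation L φ → ∀ u w : ℝ → ℝ,
          (IsDisplacement L φ u w ↔ ∃ Cu Cw : ℝ, ∀ x ∈ Set.Icc 0 L,
            u x = Cu - x - 2 * d.ktil / d.btil * cn (d.atil α + d.btil * x) d.ktil * Real.sin α
              + (2 / d.btil * EJ (am (d.atil α + d.btil * x) d.ktil) d.ktil - x)
                * Real.cos α ∧
            w x = Cw + 2 * d.ktil / d.btil * cn (d.atil α + d.btil * x) d.ktil * Real.cos α
              + (2 / d.btil * EJ (am (d.atil α + d.btil * x) d.ktil) d.ktil - x)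
                * Real.sin α))) := by
  have h : d.IsNondegenerate := ⟨hEI, hd⟩
  refine ⟨d.exists_isPhase, EndData.isPhase_arctan, h.c₁_add_A_pos, EndData.k_eq hEI.ne',
    fun α hα => ⟨hα.one_lt_k_iff h, hα.isRotation_iff h hL, fun hF φ hφ u w => ?_, fun hk => ?_⟩⟩
  · exact hα.isDisplacement_iff h hL hF hφ u w
  · have hF : 0 < d.F := EndData.F_pos_of_one_lt_k hk
    exact ⟨hα.ktil_eq hEI.ne' hF.ne', hα.atil_eq h hk, h.btil_eq, hα.isRotation_iff_ktil h hL hk,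
      fun φ hφ u w => hα.isDisplacement_iff_ktil h hL hk hφ u w⟩
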